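/- **Theorem 3.1.** Let $G$ be a finite subgroup of $\mathrm{SU}_2$, let $V=\mathbb C^2$ be its natural module of column vectors (with $G$ acting by matrix multiplication), and let $\chi_V$ be the character of $V$. Let $G$ act on the tensor algebra $\mathsf T(V)=\bigoplus_{k\ge 0}V^{\otimes k}$ by extending its action on $V$ to algebra automorphisms, let $\mathsf T(V)^G$ be the subspace of $G$-invariants, and let $$m^0(t)=\sum_{k\ge 0}\dim\big(\mathsf T(V)^G\cap V^{\otimes k}\big)\,t^k\in\mathbb C[[t]]$$ be its Poincaré series. Let $\{G^\lambda\}_{\lambda\in\Lambda(G)}$ be the irreducible complex $G$-modules up to isomorphism, with $G^0$ the trivial module. Let $\mathrm A=(a_{\mu,\lambda})_{\mu,\lambda\in\Lambda(G)}$ be the adjacency matrix of the representation graph of $V$ (the graph that the McKay correspondence attaches to $G$, called the affine Dynkin diagram of $G$); that is, $a_{\mu,\lambda}=\dim\mathrm{Hom}_G(G^\lambda,G^\mu\otimes V)$ is the multiplicity of $G^\lambda$ in $G^\mu\otimes V$. Let $\mathring{\mathrm A}$ be the adjacency matrix of the graph obtained by removing the (affine) node $0$, i.e. $\mathrm A$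 with the row and column of the trivial module deleted. Let $\Gamma\subseteq G$ be any set of representatives of the conjugacy classes of $G$. Then $\det(\mathrm I-t\mathrm A)$ and $\prod_{g\in\Gamma}(1-\chi_V(g)t)$ are invertible in $\mathbb C[[t]]$, and $$m^0(t)=\frac{\det(\mathrm I-t\mathring{\mathrm A})}{\det(\mathrm I-t\mathrm A)}=\frac{\det(\mathrm I-t\mathring{\mathrm A})}{\prod_{g\in\Gamma}\big(1-\chi_V(g)\,t\big)},$$ where the determinant of the empty matrix is $1$. -/

import Mathlib

open CategoryTheory MonoidalCategory

open scoped PowerSeries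

noncomputable section

namespace TensorInvariants

/-! ### Irreducible modules and the representation graph -/

section Irreducibles

variable (G : Type) [Group G]

/-- Two simple finite-dimensional complex `G`-modules are identified when they are isomorphic. -/
def irrSetoid : Setoid {W : FDRep ℂ G // Simple W} where
  r S T := Nonempty (S.1 ≅ T.1)
  iseqv :=
    { refl := fun S => ⟨Iso.refl S.1⟩
      symm := fun ⟨e⟩ => ⟨e.symm⟩
      trans := fun ⟨e⟩ ⟨f⟩ => ⟨e.trans f⟩ }

/-- The index set `Λ(G)`: isomorphism classes of simple finite-dimensional complex `G`-modules. -/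
def Irr : Type 1 := Quotient (irrSetoid G)

variable {G}

/-- The isomorphism class of a simple `G`-module. -/
def Irr.mk (W : FDRep ℂ G) (hW : Simple W) : Irr G := Quotient.mk (irrSetoid G) ⟨W, hW⟩

/-- A simple module `G^lam` in the isomorphism class `lam`. -/
def Irr.module (lam : Irr G) : FDRep ℂ G := (Quotient.out lam).1

instance (lam : Irr G) : Simple lam.module := (Quotient.out lam).2

theorem Irr.eq_of_iso {lam mu : Irr G} (e : lam.module ≅ mu.module) : lam = mu := by
  rw [← Quotient.out_eq lam, ← Quotient.out_eq mu]
  exact Quotient.sound ⟨e⟩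

section FiniteGroup

variable [Finite G]

/-- A finite group has finitely many irreducible modules, as their characters are
linearly independent functions on the group. -/
instance : Finite (Irr G) := by
  classical
  cases nonempty_fintype G
  have : Invertible (Nat.card G : ℂ) := invertibleOfNonzero (by simp)
  have hli : LinearIndependent ℂ (fun lam : Irr G => lam.module.character) := by
    rw [linearIndependent_iff']
    intro s c hc mu hmu
    have h1 : ∑ lam ∈ s, c lam * ((Nat.card G : ℂ)⁻¹ *
        ∑ g : G, lam.module.character g * mu.module.character g⁻¹) = 0 := by
      have h2 : ∀ g : G, ∑ lam ∈ s, c lam * lam.module.character g = 0 := by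
        intro g
        simpa using congrFun hc g
      calc _ = (Nat.card G : ℂ)⁻¹ * ∑ g : G, (∑ lam ∈ s, c lam * lam.module.character g) *
              mu.module.character g⁻¹ := by
            simp only [Finset.mul_sum, Finset.sum_mul]
            rw [Finset.sum_comm]
            refine Finset.sum_congr rfl fun g _ => Finset.sum_congr rfl fun lam _ => ?_
            ring
        _ = 0 := by simp [h2]
    rw [Finset.sum_eq_single mu] at h1
    · rw [FDRep.char_orthonormal, if_pos ⟨Iso.refl _⟩] at h1
      simpa using h1
    · intro lam _ hne
      rw [FDRep.char_orthonormal, if_neg, mul_zero]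
      rintro ⟨e⟩
      exact hne (Irr.eq_of_iso e)
    · exact fun h => absurd hmu h
  exact hli.finite

instance : Fintype (Irr G) := Fintype.ofFinite _

instance : DecidableEq (Irr G) := Classical.decEq _

variable (G) in
/-- The one-dimensional module on which every element of `G` acts as the identity. -/
def trivialModule : FDRep ℂ G := FDRep.of (Representation.trivial ℂ G ℂ)

theorem simple_trivialModule : Simple (trivialModule G) := by
  cases nonempty_fintype G
  rw [FDRep.simple_iff_char_is_norm_one]
  have h : ∀ g : G, (trivialModule G).character g = 1 := by
    intro g
    change LinearMap.trace ℂ ℂ (Representation.trivial ℂ G ℂ g) = 1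
    have : Representation.trivial ℂ G ℂ g = 1 := rfl
    rw [this, LinearMap.trace_one]
    simp
  simp [h]

variable (G) in
/-- The node `0` of the representation graph: the class of the trivial module. -/
def Irr.triv : Irr G := Irr.mk (trivialModule G) simple_trivialModule

/-- The adjacency matrix `A = (a_{mu,lam})` of the representation graph of `V`: its entry
`a_{mu,lam}` is the multiplicity `dim Hom_G(G^lam, G^mu ⊗ V)` of `G^lam` in `G^mu ⊗ V`. -/
def adjMatrix (V : FDRep ℂ G) : Matrix (Irr G) (Irr G) ℕ :=
  Matrix.of fun mu lam => Module.finrank ℂ (lam.module ⟶ mu.module ⊗ V)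

/-- The adjacency matrix of the graph obtained by removing the trivial node. -/
def reducedAdjMatrix (V : FDRep ℂ G) :
    Matrix {lam : Irr G // lam ≠ Irr.triv G} {lam : Irr G // lam ≠ Irr.triv G} ℕ :=
  (adjMatrix V).submatrix Subtype.val Subtype.val

end FiniteGroup

end Irreducibles

/-- `det(I - tB)` for a square matrix `B` of natural numbers, as a power series in `t`. -/
def detOneSub {ι : Type*} [Fintype ι] [DecidableEq ι] (B : Matrix ι ι ℕ) : ℂ⟦X⟧ :=
  (1 - (PowerSeries.X : ℂ⟦X⟧) • B.map (Nat.cast : ℕ → ℂ⟦X⟧)).det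

/-! ### Invariants in the tensor algebra -/

section TensorAlgebra

variable {G V : Type*} [Group G] [AddCommGroup V] [Module ℂ V]

/-- The action of `G` on the tensor algebra `T(V)`: the element `g` acts by the algebra
endomorphism that extends its action on `V`, that is, diagonally on each tensor power. -/
def tensorAlgebraRep (ρ : Representation ℂ G V) : Representation ℂ G (TensorAlgebra ℂ V) where
  toFun g := (TensorAlgebra.lift ℂ (TensorAlgebra.ι ℂ ∘ₗ ρ g)).toLinearMap
  map_one' := by
    have : TensorAlgebra.lift ℂ (TensorAlgebra.ι ℂ ∘ₗ ρ 1) = AlgHom.id ℂ (TensorAlgebra ℂ V) := by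
      ext v; simp
    rw [this]; rfl
  map_mul' g h := by
    have : TensorAlgebra.lift ℂ (TensorAlgebra.ι ℂ ∘ₗ ρ (g * h)) =
        (TensorAlgebra.lift ℂ (TensorAlgebra.ι ℂ ∘ₗ ρ g)).comp
          (TensorAlgebra.lift ℂ (TensorAlgebra.ι ℂ ∘ₗ ρ h)) := by
      ext v; simp
    rw [this]; rfl

/-- The degree `k` component `V^{⊗k}` of the tensor algebra `T(V)`. -/
def tensorDegree (V : Type*) [AddCommGroup V] [Module ℂ V] (k : ℕ) :
    Submodule ℂ (TensorAlgebra ℂ V) :=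
  LinearMap.range (TensorAlgebra.ι ℂ : V →ₗ[ℂ] TensorAlgebra ℂ V) ^ k

/-- The Poincaré series `∑_k dim (T(V)^G ∩ V^{⊗k}) t^k` of the invariants `T(V)^G`. -/
def poincareSeries (ρ : Representation ℂ G V) : ℂ⟦X⟧ :=
  PowerSeries.mk fun k =>
    (Module.finrank ℂ ((tensorAlgebraRep ρ).invariants ⊓ tensorDegree V k :
      Submodule ℂ (TensorAlgebra ℂ V)) : ℂ)

end TensorAlgebra

/-! ### Subgroups of `SU₂` -/

/-- The natural representation of a subgroup of `SU₂` on the column vectors `ℂ²`, by matrix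
multiplication. -/
def natRep (G : Subgroup (Matrix.specialUnitaryGroup (Fin 2) ℂ)) :
    Representation ℂ G (Fin 2 → ℂ) where
  toFun g := Matrix.mulVecLin (g : Matrix.specialUnitaryGroup (Fin 2) ℂ).1
  map_one' := by ext; simp
  map_mul' g h := by ext; simp

/-- The natural module `V = ℂ²` as an object of the category of finite-dimensional modules. -/
def natModule (G : Subgroup (Matrix.specialUnitaryGroup (Fin 2) ℂ)) : FDRep ℂ G :=
  FDRep.of (natRep G)

/-- `R` contains exactly one element of each conjugacy class of `G`. -/
def IsConjRepresentatives {G : Type*} [Group G] (R : Finset G) : Prop :=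
  ∀ g : G, ∃! r : G, r ∈ R ∧ IsConj r g

end TensorInvariants

end

open CategoryTheory MonoidalCategory

open scoped PowerSeries

noncomputable section

namespace TensorInvariants

/-! ### Determinants of minors -/

/-! Both sides count closed walks at the trivial node. By Cramer's rule the `(0,0)` entry of `∑ A^k
t^k = (I - tA)⁻¹` is a principal minor over `det (I - tA)` (`mk_pow_apply_mul_detOneSub`). Its
coefficients `(A^k)₀₀` are matched with the dimensions of invariants through characters: both equal
the average of `χ_V ^ k` over `G` (`coeff_poincareSeries`, `adjMatrix_pow_triv_triv`).

The character table diagonalizes `A` with eigenvalues `χ_V(g)`, one per conjugacy class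
(`adjMatrix_eq`), which gives the product formula. Inverting the table on both sides requires
completeness of the irreducible characters (`eq_zero_of_orthogonal`), proved with Schur's lemma,
Maschke's theorem and the regular representation. -/

/-- A diagonal entry of the adjugate is the corresponding principal minor. -/
theorem adjugate_apply_self {ι S : Type*} [Fintype ι] [DecidableEq ι] [CommRing S]
    (M : Matrix ι ι S) (i : ι) :
    M.adjugate i i = (M.submatrix (Subtype.val : {j // j ≠ i} → ι) Subtype.val).det := by
  rw [Matrix.adjugate_apply, Matrix.twoBlockTriangular_det' _ (fun j => j = i)]
  · have h1 (p : ι → Prop) [DecidablePred p] (hp : ∀ j, p j ↔ j = i) :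
        ((M.updateRow i (Pi.single i 1)).toSquareBlockProp p).det = 1 := by
      have : Subsingleton {j // p j} :=
        ⟨fun a b => Subtype.ext (((hp _).mp a.2).trans ((hp _).mp b.2).symm)⟩
      rw [Matrix.det_eq_elem_of_subsingleton _ (⟨i, (hp i).mpr rfl⟩ : {j // p j})]
      simp [Matrix.toSquareBlockProp]
    rw [h1 _ fun _ => Iff.rfl, one_mul]
    congr 1
    ext a b
    simp [Matrix.toSquareBlockProp, Matrix.updateRow_ne a.2]
  · rintro j rfl l hl
    simp [hl]

theorem constantCoeff_detOneSub {ι : Type*} [Fintype ι] [DecidableEq ι] (B : Matrix ι ι ℕ) :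
    PowerSeries.constantCoeff (detOneSub B) = 1 := by
  rw [detOneSub, RingHom.map_det]
  convert Matrix.det_one (R := ℂ) (n := ι)
  ext i j
  simp [Matrix.one_apply, apply_ite]

theorem isUnit_detOneSub {ι : Type*} [Fintype ι] [DecidableEq ι] (B : Matrix ι ι ℕ) :
    IsUnit (detOneSub B) := by
  rw [PowerSeries.isUnit_iff_constantCoeff, constantCoeff_detOneSub]
  exact isUnit_one

/-- The generating function of closed walks at `i` times `det(I - tB)` is the principal minor
at `i`. -/
theorem mk_pow_apply_mul_detOneSub {ι : Type*} [Fintype ι] [DecidableEq ι] (B : Matrix ι ι ℕ)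
    (i : ι) :
    PowerSeries.mk (fun k => (((B ^ k) i i : ℕ) : ℂ)) * detOneSub B =
      detOneSub (B.submatrix (Subtype.val : {j // j ≠ i} → ι) Subtype.val) := by
  set M : Matrix ι ι ℂ⟦X⟧ :=
    1 - (PowerSeries.X : ℂ⟦X⟧) • B.map (Nat.cast : ℕ → ℂ⟦X⟧) with hM
  set F : Matrix ι ι ℂ⟦X⟧ :=
    Matrix.of fun a b => PowerSeries.mk fun k => (((B ^ k) a b : ℕ) : ℂ) with hF
  have hFM : F * M = 1 := by
    -- The recursion `B ^ (k + 1) = B ^ k * B`, read coefficientwise.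
    have h : F = 1 + (PowerSeries.X : ℂ⟦X⟧) • (F * B.map (Nat.cast : ℕ → ℂ⟦X⟧)) := by
      ext a b k
      cases k with
      | zero => simp [hF, Matrix.one_apply, apply_ite]
      | succ k =>
        have hcast (n : ℕ) : (n : ℂ⟦X⟧) = PowerSeries.C (n : ℂ) := by simp
        simp only [hF, Matrix.of_apply, PowerSeries.coeff_mk, Matrix.add_apply, Matrix.smul_apply,
          smul_eq_mul, map_add, PowerSeries.coeff_succ_X_mul, Matrix.mul_apply, Matrix.map_apply,
          map_sum, hcast, PowerSeries.coeff_mul_C, pow_succ, Nat.cast_sum, Nat.cast_mul]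
        rw [Matrix.one_apply]
        split_ifs <;> simp [PowerSeries.coeff_one]
    rw [hM, mul_sub, mul_one, Matrix.mul_smul]
    nth_rewrite 1 [h]
    abel
  have hadj : M.det • F = M.adjugate := by
    calc M.det • F = F * (M.det • (1 : Matrix ι ι ℂ⟦X⟧)) := by simp
      _ = F * (M * M.adjugate) := by rw [Matrix.mul_adjugate]
      _ = M.adjugate := by rw [← mul_assoc, hFM, one_mul]
  have hii := congrFun (congrFun hadj i) i
  rw [adjugate_apply_self, Matrix.smul_apply, smul_eq_mul, mul_comm] at hii
  rw [detOneSub, ← hM]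
  refine hii.trans ?_
  rw [detOneSub]
  congr 1
  ext a b : 2
  simp [hM, Matrix.one_apply, Subtype.ext_iff]


/-! ### Tensor powers -/

/-- The trace of a tensor power of an endomorphism. -/
theorem trace_piTensorProduct_map {K V : Type*} [Field K] [AddCommGroup V] [Module K V]
    [FiniteDimensional K V] (f : V →ₗ[K] V) (k : ℕ) :
    LinearMap.trace K _ (PiTensorProduct.map (fun _ : Fin k => f)) = LinearMap.trace K V f ^ k := by
  classical
  let b := Module.finBasis K V
  rw [LinearMap.trace_eq_matrix_trace K (Basis.piTensorProduct fun _ : Fin k => b),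
    LinearMap.trace_eq_matrix_trace K b, Matrix.trace, Matrix.trace, ← Fin.prod_const,
    Finset.prod_univ_sum, Fintype.piFinset_univ]
  refine Finset.sum_congr rfl fun p _ => ?_
  simp [LinearMap.toMatrix_apply, Basis.piTensorProduct_apply,
    Basis.piTensorProduct_repr_tprod_apply]

section

variable {G V : Type*} [Group G] [AddCommGroup V] [Module ℂ V]

/-- The diagonal representation on the `k`-th tensor power. -/
def tensorPowerRep (ρ : Representation ℂ G V) (k : ℕ) :
    Representation ℂ G (PiTensorProduct ℂ fun _ : Fin k => V) :=
  PiTensorProduct.mapMonoidHom.comp (MonoidHom.pi fun _ : Fin k => ρ)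

theorem tensorPowerRep_apply (ρ : Representation ℂ G V) (k : ℕ) (g : G) :
    tensorPowerRep ρ k g = PiTensorProduct.map (fun _ : Fin k => ρ g) := rfl

theorem toTensorAlgebra_tensorPowerRep (ρ : Representation ℂ G V) (k : ℕ) (g : G)
    (x : PiTensorProduct ℂ fun _ : Fin k => V) :
    TensorPower.toTensorAlgebra (tensorPowerRep ρ k g x) =
      tensorAlgebraRep ρ g (TensorPower.toTensorAlgebra x) := by
  have h : TensorPower.toTensorAlgebra ∘ₗ tensorPowerRep ρ k g =
      tensorAlgebraRep ρ g ∘ₗ TensorPower.toTensorAlgebra := by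
    ext v
    simp only [LinearMap.compMultilinearMap_apply, LinearMap.comp_apply, tensorPowerRep_apply,
      PiTensorProduct.map_tprod, TensorPower.toTensorAlgebra_tprod, TensorAlgebra.tprod_apply]
    change _ = TensorAlgebra.lift ℂ (TensorAlgebra.ι ℂ ∘ₗ ρ g) _
    rw [map_list_prod, List.map_ofFn]
    congr 2
    ext i
    simp
  exact LinearMap.congr_fun h x

/-- Under `T(V) ≅ ⨁ V^{⊗n}` this map is the inclusion of the `k`-th summand. -/
theorem toTensorAlgebra_injective (k : ℕ) :
    Function.Injective (TensorPower.toTensorAlgebra (R := ℂ) (M := V) (n := k)) := by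
  intro x y h
  have key : ∀ z : TensorPower ℂ k V, TensorAlgebra.ofDirectSum
      (DirectSum.of (fun n => TensorPower ℂ n V) k z) = TensorPower.toTensorAlgebra z := by
    refine LinearMap.congr_fun (f := TensorAlgebra.ofDirectSum.toLinearMap ∘ₗ
      DirectSum.lof ℂ ℕ (fun n => TensorPower ℂ n V) k) ?_
    ext v
    simp [DirectSum.lof_eq_of]
  rw [← key, ← key] at h
  exact DirectSum.of_injective k
    ((TensorAlgebra.equivDirectSum (R := ℂ) (M := V)).symm.injective h)

theorem range_toTensorAlgebra (k : ℕ) :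
    LinearMap.range (TensorPower.toTensorAlgebra (R := ℂ) (M := V) (n := k)) =
      tensorDegree V k := by
  rw [tensorDegree, Submodule.pow_eq_span_pow_set, LinearMap.range_eq_map,
    ← PiTensorProduct.span_tprod_eq_top, Submodule.map_span]
  congr 1
  ext x
  rw [Set.mem_pow]
  constructor
  · rintro ⟨_, ⟨v, rfl⟩, rfl⟩
    exact ⟨fun i => ⟨TensorAlgebra.ι ℂ (v i), v i, rfl⟩, by
      rw [TensorPower.toTensorAlgebra_tprod, TensorAlgebra.tprod_apply]⟩
  · rintro ⟨f, rfl⟩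
    choose v hv using fun i => (f i).2
    refine ⟨_, ⟨v, rfl⟩, ?_⟩
    rw [TensorPower.toTensorAlgebra_tprod, TensorAlgebra.tprod_apply]
    simp only [hv]

/-- The embedding of `V^{⊗k}` is equivariant and injective, so invariance may be tested before or
after it. -/
theorem map_invariants_tensorPowerRep (ρ : Representation ℂ G V) (k : ℕ) :
    (tensorPowerRep ρ k).invariants.map TensorPower.toTensorAlgebra =
      (tensorAlgebraRep ρ).invariants ⊓ tensorDegree V k := by
  rw [← range_toTensorAlgebra]
  ext x
  constructor
  · rintro ⟨y, hy, rfl⟩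
    exact ⟨fun g => by rw [← toTensorAlgebra_tensorPowerRep, hy g], y, rfl⟩
  · rintro ⟨hx, y, rfl⟩
    refine ⟨y, fun g => toTensorAlgebra_injective k ?_, rfl⟩
    rw [toTensorAlgebra_tensorPowerRep]
    exact hx g

/-- The number of invariants in the `k`-th tensor power is the average of `χ_V ^ k`. -/
theorem coeff_poincareSeries [Fintype G] [FiniteDimensional ℂ V] (ρ : Representation ℂ G V)
    (k : ℕ) :
    PowerSeries.coeff k (poincareSeries ρ) =
      (Nat.card G : ℂ)⁻¹ * ∑ g : G, ρ.character g ^ k := by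
  have : Invertible (Nat.card G : ℂ) := invertibleOfNonzero (by simp)
  rw [poincareSeries, PowerSeries.coeff_mk, ← map_invariants_tensorPowerRep,
    ← (Submodule.equivMapOfInjective _ (toTensorAlgebra_injective k) _).finrank_eq,
    ← Representation.card_inv_mul_sum_char_eq_finrank]
  simp only [Representation.character, tensorPowerRep_apply, trace_piTensorProduct_map]

end


/-! ### Completeness of the irreducible characters -/

section

variable {G : Type} [Group G] [Fintype G]

theorem exists_irr_character_eq {V : Type} [AddCommGroup V] [Module ℂ V] [FiniteDimensional ℂ V]
    (ρ : Representation ℂ G V) (hρ : ρ.IsIrreducible) :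
    ∃ lam : Irr G, lam.module.character = ρ.character := by
  have : Invertible (Nat.card G : ℂ) := invertibleOfNonzero (by simp)
  have hS : Simple (FDRep.of ρ) := by
    rw [FDRep.simple_iff_char_is_norm_one]
    have h := Representation.char_orthonormal ρ ρ
    rw [if_pos ⟨Representation.Equiv.refl ρ⟩, inv_mul_eq_iff_eq_mul₀ (by simp), mul_one] at h
    exact h
  obtain ⟨e⟩ : Nonempty ((Irr.mk (FDRep.of ρ) hS).module ≅ FDRep.of ρ) :=
    Quotient.mk_out (s := irrSetoid G) ⟨FDRep.of ρ, hS⟩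
  exact ⟨_, (FDRep.char_iso e).trans rfl⟩

/-- A class function orthogonal to all irreducible characters acts as zero in every
finite-dimensional representation. -/
theorem sum_smul_eq_zero_of_orthogonal (f : G → ℂ) (hf : ∀ g h, f (h * g * h⁻¹) = f g)
    (horth : ∀ lam : Irr G, ∑ g, f g * lam.module.character g = 0) (n : ℕ) :
    ∀ (V : Type) [AddCommGroup V] [Module ℂ V] [FiniteDimensional ℂ V]
      (ρ : Representation ℂ G V), Module.finrank ℂ V = n → ∑ g, f g • ρ g = 0 := by
  induction n using Nat.strong_induction_on with
  | _ n ih =>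
  intro V _ _ _ ρ hn
  rcases subsingleton_or_nontrivial V with hV | hV
  · exact Subsingleton.elim _ _
  by_cases hirr : ρ.IsIrreducible
  -- As `f` is a class function, the operator commutes with `G`, so it is a scalar by Schur; its
  -- trace vanishes by `horth`, so the scalar is zero.
  · have hcomm (h : G) : (∑ g, f g • ρ g) ∘ₗ ρ h = ρ h ∘ₗ ∑ g, f g • ρ g := by
      change (∑ g, f g • ρ g) * ρ h = ρ h * ∑ g, f g • ρ g
      rw [Finset.sum_mul, Finset.mul_sum]
      refine Fintype.sum_equiv (MulAut.conj h⁻¹).toEquiv _ _ fun g => ?_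
      have h1 : f (h⁻¹ * (g * h)) = f g := by simpa [mul_assoc] using hf g h⁻¹
      simp [← map_mul, mul_assoc, h1]
    obtain ⟨c, hc⟩ :=
      Representation.IsIrreducible.algebraMap_intertwiningMap_bijective_of_isAlgClosed.surjective
        (⟨∑ g, f g • ρ g, hcomm⟩ : Representation.IntertwiningMap ρ ρ)
    have hc' : ∑ g, f g • ρ g = c • LinearMap.id := by
      have := congrArg Representation.IntertwiningMap.toLinearMap hc
      exact this.symm
    obtain ⟨lam, hlam⟩ := exists_irr_character_eq ρ hirr
    have htr : LinearMap.trace ℂ V (∑ g, f g • ρ g) = 0 := by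
      rw [map_sum, ← horth lam, hlam]
      simp [Representation.character]
    rw [hc'] at htr ⊢
    have hdim : (Module.finrank ℂ V : ℂ) ≠ 0 := by
      exact_mod_cast Module.finrank_pos.ne'
    rw [map_smul, LinearMap.trace_id, smul_eq_mul] at htr
    rw [(mul_eq_zero.mp htr).resolve_right hdim, zero_smul]
  · have hsub (W : Subrepresentation ρ) (hW : W ≠ ⊤) (w : V) (hw : w ∈ W) :
        (∑ g, f g • ρ g) w = 0 := by
      have hlt : Module.finrank ℂ W.toSubmodule < n := by
        rw [← hn]
        refine Submodule.finrank_lt fun h => hW ?_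
        exact Subrepresentation.toSubmodule_injective h
      have h := ih _ hlt W.toSubmodule W.toRepresentation rfl
      have h2 := congrArg Subtype.val (LinearMap.congr_fun h ⟨w, hw⟩)
      simpa [LinearMap.sum_apply, Subrepresentation.toRepresentation] using h2
    have : NeZero (Nat.card G : ℂ) := ⟨by simp⟩
    obtain ⟨W, hbot, htop⟩ : ∃ W : Subrepresentation ρ, W ≠ ⊥ ∧ W ≠ ⊤ := by
      by_contra! hcon
      refine hirr { exists_pair_ne := ⟨⊥, ⊤, fun h => ?_⟩, eq_bot_or_eq_top := fun W => ?_ }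
      · exact bot_ne_top (congrArg Subrepresentation.toSubmodule h)
      · exact or_iff_not_imp_left.mpr (hcon W)
    -- Maschke's theorem: both summands are proper, so induction applies to each.
    obtain ⟨W', hW'⟩ := exists_isCompl W
    have htop' : W' ≠ ⊤ := fun h => hbot (by simpa [h] using hW'.inf_eq_bot)
    ext v
    have hv : v ∈ W.toSubmodule ⊔ W'.toSubmodule := by
      rw [← Subrepresentation.toSubmodule_sup, hW'.sup_eq_top]
      exact Submodule.mem_top
    obtain ⟨w, hw, w', hw', rfl⟩ := Submodule.mem_sup.mp hv
    rw [map_add, hsub W htop w hw, hsub W' htop' w' hw']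
    simp

/-- The irreducible characters span the class functions. -/
theorem eq_zero_of_orthogonal (f : G → ℂ) (hf : ∀ g h, f (h * g * h⁻¹) = f g)
    (horth : ∀ lam : Irr G, ∑ g, f g * lam.module.character g = 0) : f = 0 := by
  classical
  have h := sum_smul_eq_zero_of_orthogonal f hf horth _ (MonoidAlgebra ℂ G)
    (Representation.leftRegular ℂ G) rfl
  ext x
  -- Applied to the unit of the group algebra, the zero operator gives `∑ g, f g • g`, whose
  -- coefficient at `x` is `f x`.
  have hx := congrArg (fun a => MonoidAlgebra.coeff a x)
    (LinearMap.congr_fun h (MonoidAlgebra.single 1 1))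
  simpa [LinearMap.sum_apply, Finsupp.single_apply] using hx

end


/-! ### The character table -/

namespace IsConjRepresentatives

variable {G : Type*} [Group G] {R : Finset G} (hR : IsConjRepresentatives R)

/-- The chosen representative of the conjugacy class of `g`. -/
def rep (g : G) : R := ⟨(hR g).choose, (hR g).choose_spec.1.1⟩

theorem isConj_rep (g : G) : IsConj (hR.rep g : G) g := (hR g).choose_spec.1.2

theorem rep_eq_of_isConj {r : R} {g : G} (h : IsConj (r : G) g) : hR.rep g = r :=
  Subtype.ext ((hR g).unique ⟨(hR.rep g).2, hR.isConj_rep g⟩ ⟨r.2, h⟩)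

theorem rep_conj (g h : G) : hR.rep (h * g * h⁻¹) = hR.rep g :=
  hR.rep_eq_of_isConj ((hR.isConj_rep g).trans (isConj_iff.mpr ⟨h, rfl⟩))

theorem rep_coe (r : R) : hR.rep r = r := hR.rep_eq_of_isConj (IsConj.refl _)

theorem apply_rep {S : Type*} {f : G → S} (hf : ∀ g h, f (h * g * h⁻¹) = f g) (g : G) :
    f (hR.rep g) = f g := by
  obtain ⟨c, hc⟩ := isConj_iff.mp (hR.isConj_rep g)
  calc f (hR.rep g) = f (c * hR.rep g * c⁻¹) := (hf _ _).symm
    _ = f g := by rw [hc]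

variable [Fintype G]

open scoped Classical in
/-- The size of the conjugacy class of `r`. -/
def classSize (r : R) : ℕ := (Finset.univ.filter fun g => hR.rep g = r).card

theorem classSize_ne_zero (r : R) : hR.classSize r ≠ 0 := by
  classical
  rw [classSize, Finset.card_ne_zero]
  exact ⟨r, by simp [hR.rep_coe]⟩

theorem sum_eq_sum_classSize {f : G → ℂ} (hf : ∀ g h, f (h * g * h⁻¹) = f g) :
    ∑ g, f g = ∑ r : R, (hR.classSize r : ℂ) * f r := by
  classical
  rw [← Finset.sum_fiberwise Finset.univ hR.rep f]
  refine Finset.sum_congr rfl fun r _ => ?_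
  rw [Finset.sum_congr rfl (g := fun _ => f r), Finset.sum_const, nsmul_eq_mul, classSize]
  intro g hg
  rw [← (Finset.mem_filter.mp hg).2, hR.apply_rep hf]

end IsConjRepresentatives

theorem char_conj_inv {G : Type} [Group G] (W : FDRep ℂ G) (g h : G) :
    W.character (h * g * h⁻¹)⁻¹ = W.character g⁻¹ := by
  rw [show (h * g * h⁻¹)⁻¹ = h * g⁻¹ * h⁻¹ by group, FDRep.char_conj]

section CharacterTable

variable {G : Type} [Group G] [Fintype G] {R : Finset G}

/-- The character table, with rows the irreducible modules and columns the conjugacy classes. -/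
def charTable (R : Finset G) : Matrix (Irr G) R ℂ := Matrix.of fun lam r => lam.module.character r

/-- The inverse of the character table, given by the orthogonality relations. -/
def charTableInv (hR : IsConjRepresentatives R) : Matrix R (Irr G) ℂ :=
  Matrix.of fun r lam =>
    (Nat.card G : ℂ)⁻¹ * ((hR.classSize r : ℂ) * lam.module.character (r : G)⁻¹)

variable (hR : IsConjRepresentatives R)

theorem character_triv (g : G) : (Irr.triv G).module.character g = 1 := by
  obtain ⟨e⟩ : Nonempty ((Irr.triv G).module ≅ trivialModule G) :=
    Quotient.mk_out (s := irrSetoid G) ⟨trivialModule G, simple_trivialModule⟩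
  rw [FDRep.char_iso e]
  change LinearMap.trace ℂ ℂ (1 : Module.End ℂ ℂ) = 1
  simp

include hR in
-- A kernel vector, divided by the class sizes, extends to a class function orthogonal to every
-- irreducible character.
theorem charTable_mulVec_injective (v : R → ℂ) (hv : (charTable R).mulVec v = 0) : v = 0 := by
  have h := eq_zero_of_orthogonal (fun g => v (hR.rep g) * (hR.classSize (hR.rep g) : ℂ)⁻¹)
    (fun g h => by rw [hR.rep_conj]) fun lam => by
      rw [hR.sum_eq_sum_classSize]
      · refine Eq.trans ?_ (congrFun hv lam)
        refine Finset.sum_congr rfl fun r _ => ?_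
        have := hR.classSize_ne_zero r
        simp only [hR.rep_coe, charTable, Matrix.of_apply]
        field_simp
      · intro g h
        rw [hR.rep_conj, FDRep.char_conj]
  ext r
  have hr := congrFun h r
  simpa [hR.rep_coe, hR.classSize_ne_zero r] using hr

variable [DecidableEq G]

include hR in
-- Used with `d = 1` for orthogonality, `d = χ_V` for the entries of `A`, and `d = χ_V ^ k` for
-- those of its powers.
theorem charTable_mul_diagonal_mul_charTableInv_apply {d : G → ℂ}
    (hd : ∀ g h, d (h * g * h⁻¹) = d g) (mu lam : Irr G) :
    (charTable R * Matrix.diagonal (fun r : R => d r) * charTableInv hR) mu lam =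
      (Nat.card G : ℂ)⁻¹ * ∑ g, mu.module.character g * d g * lam.module.character g⁻¹ := by
  rw [hR.sum_eq_sum_classSize, Matrix.mul_apply, Finset.mul_sum]
  · refine Finset.sum_congr rfl fun r _ => ?_
    simp only [Matrix.mul_diagonal, charTable, charTableInv, Matrix.of_apply]
    ring
  · intro g h
    rw [char_conj_inv, FDRep.char_conj, hd]

theorem charTable_mul_charTableInv : charTable R * charTableInv hR = 1 := by
  have : Invertible (Nat.card G : ℂ) := invertibleOfNonzero (by simp)
  ext mu lam
  have h := charTable_mul_diagonal_mul_charTableInv_apply hR (d := fun _ => 1)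
    (fun _ _ => rfl) mu lam
  rw [Matrix.diagonal_one, Matrix.mul_one] at h
  rw [h]
  simp only [mul_one]
  rw [FDRep.char_orthonormal, Matrix.one_apply]
  congr 1
  exact propext ⟨fun ⟨e⟩ => Irr.eq_of_iso e, fun h => h ▸ ⟨Iso.refl _⟩⟩

/-- The index types `Irr G` and `R` differ, so a right inverse is not automatically a left one;
injectivity of the table supplies the cancellation. -/
theorem charTableInv_mul_charTable : charTableInv hR * charTable R = 1 := by
  rw [← sub_eq_zero]
  ext r s
  have h : charTable R * (charTableInv hR * charTable R - 1 : Matrix R R ℂ) = 0 := by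
    rw [Matrix.mul_sub, ← Matrix.mul_assoc, charTable_mul_charTableInv, Matrix.one_mul, Matrix.mul_one,
      sub_self]
  refine congrFun (charTable_mulVec_injective hR
    (fun r => (charTableInv hR * charTable R - 1 : Matrix R R ℂ) r s) ?_) r
  ext lam
  exact congrFun (congrFun h lam) s

theorem adjMatrix_eq (V : FDRep ℂ G) :
    (adjMatrix V).map (Nat.cast : ℕ → ℂ) =
      charTable R * Matrix.diagonal (fun r : R => V.character r) * charTableInv hR := by
  have : Invertible (Nat.card G : ℂ) := invertibleOfNonzero (by simp)
  ext mu lam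
  rw [charTable_mul_diagonal_mul_charTableInv_apply hR (fun g h => V.char_conj g h),
    Matrix.map_apply, adjMatrix, Matrix.of_apply,
    ← FDRep.scalar_product_char_eq_finrank_equivariant, FDRep.char_tensor]
  rfl

theorem adjMatrix_pow_eq (V : FDRep ℂ G) (k : ℕ) :
    (adjMatrix V ^ k).map (Nat.cast : ℕ → ℂ) =
      charTable R * Matrix.diagonal (fun r : R => V.character r ^ k) * charTableInv hR := by
  induction k with
  | zero => simp [charTable_mul_charTableInv]
  | succ k ih =>
    have h : (adjMatrix V ^ (k + 1)).map (Nat.cast : ℕ → ℂ) =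
        (adjMatrix V ^ k).map (Nat.cast : ℕ → ℂ) * (adjMatrix V).map (Nat.cast : ℕ → ℂ) := by
      rw [pow_succ]
      exact Matrix.map_mul (f := Nat.castRingHom ℂ)
    rw [h, ih, adjMatrix_eq hR V]
    calc _ = charTable R * Matrix.diagonal (fun r : R => V.character r ^ k) *
          (charTableInv hR * charTable R) * Matrix.diagonal (fun r : R => V.character r) *
          charTableInv hR := by simp only [Matrix.mul_assoc]
      _ = _ := by
        rw [charTableInv_mul_charTable, Matrix.mul_one, Matrix.mul_assoc (charTable R),
          Matrix.diagonal_mul_diagonal]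
        simp only [pow_succ]

include hR in
/-- `det(I - tA)` is the product of `1 - χ_V(g) t` over the conjugacy classes of `G`. -/
theorem detOneSub_adjMatrix (V : FDRep ℂ G) :
    detOneSub (adjMatrix V) =
      ∏ g ∈ R, (1 - PowerSeries.C (V.character g) * PowerSeries.X) := by
  have hA : (PowerSeries.X : ℂ⟦X⟧) • (adjMatrix V).map (Nat.cast : ℕ → ℂ⟦X⟧) =
      ((charTable R).map PowerSeries.C) * ((PowerSeries.X : ℂ⟦X⟧) •
        ((Matrix.diagonal (fun r : R => V.character r)).map PowerSeries.C *
          (charTableInv hR).map PowerSeries.C)) := by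
    rw [Matrix.mul_smul, ← Matrix.map_mul, ← Matrix.map_mul, ← Matrix.mul_assoc,
      ← adjMatrix_eq hR V, Matrix.map_map]
    congr 2
  -- `det (1 - MN) = det (1 - NM)` for rectangular `M`, `N` moves the determinant from `Irr G` to
  -- `R`, where the matrix is diagonal.
  rw [detOneSub, hA, Matrix.det_one_sub_mul_comm, Matrix.smul_mul, Matrix.mul_assoc,
    ← Matrix.map_mul (L := charTableInv hR), charTableInv_mul_charTable]
  have hD : 1 - (PowerSeries.X : ℂ⟦X⟧) •
      ((Matrix.diagonal (fun r : R => V.character r)).map PowerSeries.C *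
        (1 : Matrix R R ℂ).map PowerSeries.C) =
      Matrix.diagonal fun r : R => 1 - PowerSeries.C (V.character r) * PowerSeries.X := by
    rw [← Matrix.map_mul, Matrix.mul_one]
    ext1 i j
    rcases eq_or_ne i j with rfl | h
    · simp [mul_comm]
    · simp [h]
  rw [hD, Matrix.det_diagonal,
    Finset.prod_coe_sort R fun g => 1 - PowerSeries.C (V.character g) * PowerSeries.X]

include hR in
-- At the trivial node both character factors are `1`, leaving the plain average.
theorem adjMatrix_pow_triv_triv (V : FDRep ℂ G) (k : ℕ) :
    (((adjMatrix V ^ k) (Irr.triv G) (Irr.triv G) : ℕ) : ℂ) =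
      (Nat.card G : ℂ)⁻¹ * ∑ g : G, V.character g ^ k := by
  have h := congrFun (congrFun (adjMatrix_pow_eq hR V k) (Irr.triv G)) (Irr.triv G)
  rw [charTable_mul_diagonal_mul_charTableInv_apply hR (d := fun g => V.character g ^ k)
    (fun g h => by rw [V.char_conj g h])] at h
  simpa [character_triv] using h

end CharacterTable

end TensorInvariants

end

open TensorInvariants in
theorem theorem3p1 (G : Subgroup (Matrix.specialUnitaryGroup (Fin 2) ℂ)) [Finite G]
    (R : Finset G) (hR : IsConjRepresentatives R) :
    IsUnit (detOneSub (adjMatrix (natModule G))) ∧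
    IsUnit (∏ g ∈ R, (1 - PowerSeries.C ((natRep G).character g) * PowerSeries.X)) ∧
    poincareSeries (natRep G) =
      detOneSub (reducedAdjMatrix (natModule G)) * (detOneSub (adjMatrix (natModule G)))⁻¹ ∧
    poincareSeries (natRep G) =
      detOneSub (reducedAdjMatrix (natModule G)) *
        (∏ g ∈ R, (1 - PowerSeries.C ((natRep G).character g) * PowerSeries.X))⁻¹ := by
  classical
  cases nonempty_fintype G
  have hunit := isUnit_detOneSub (adjMatrix (natModule G))
  have hdet : detOneSub (adjMatrix (natModule G)) =
      ∏ g ∈ R, (1 - PowerSeries.C ((natRep G).character g) * PowerSeries.X) :=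
    detOneSub_adjMatrix hR (natModule G)
  have hmk : poincareSeries (natRep G) = PowerSeries.mk fun k =>
      (((adjMatrix (natModule G) ^ k) (Irr.triv G) (Irr.triv G) : ℕ) : ℂ) := by
    ext k
    rw [coeff_poincareSeries, PowerSeries.coeff_mk, adjMatrix_pow_triv_triv hR]
    rfl
  have hseries : poincareSeries (natRep G) =
      detOneSub (reducedAdjMatrix (natModule G)) * (detOneSub (adjMatrix (natModule G)))⁻¹ := by
    rw [PowerSeries.eq_mul_inv_iff_mul_eq (by rw [constantCoeff_detOneSub]; exact one_ne_zero), hmk]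
    exact mk_pow_apply_mul_detOneSub _ _
  exact ⟨hunit, hdet ▸ hunit, hseries, hdet ▸ hseries⟩
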